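/- Let $a<b$ be real numbers. For $g:\,]a,b[\,\to\mathbb R$ let $T_g]a,b[\,\in[0,+\infty]$ be the supremum of the total variations of $g$ in the closed subintervals $[c,d]\subset\,]a,b[$. For $f\in L^1]a,b[$ define the essential variation \[ e\text{-}T_f]a,b[\;=\;\inf\{\,T_g]a,b[\;:\;g:\,]a,b[\,\to\mathbb R,\ g=f \text{ almost everywhere in } ]a,b[\,\}\in[0,+\infty]. \] Let $BVL^1]a,b[$ be the set of those $f\in L^1]a,b[$ whose distributional derivative is represented by a finite signed Radon measure $Df$ in $]a,b[$ of finite total variation $|Df|(]a,b[)$, that is, \[ \int_{]a,b[} f\,\phi'\,dx=-\int_{]a,b[}\phi\,dDf\qquad\text{for all }\phi\in C_c^\infty]a,b[. \] Then for every $f\in L^1]a,b[$, \[ e\text{-}T_f]a,b[\;<+\infty\iff f\in BVL^1]a,b[, \] and in that case $|Df|(]a,b[)=e\text{-}T_f]a,b[$. -/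

import Mathlib

open Set MeasureTheory
open scoped ENNReal

namespace EssVar

/-- The total variation of `f` in the open interval `]a,b[`: the supremum of the total variations
of `f` in the closed intervals `[c,d] ⊆ ]a,b[`. -/
noncomputable def totalVar (f : ℝ → ℝ) (a b : ℝ) : ℝ≥0∞ :=
  ⨆ (c : ℝ) (d : ℝ) (_ : a < c) (_ : c < d) (_ : d < b), eVariationOn f (Icc c d)

/-- The essential variation of `f` in `]a,b[`: the infimum of the total variations in `]a,b[` of
the functions that are equal to `f` almost everywhere in `]a,b[`. -/
noncomputable def essVar (f : ℝ → ℝ) (a b : ℝ) : ℝ≥0∞ :=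
  ⨅ (g : ℝ → ℝ) (_ : g =ᵐ[volume.restrict (Ioo a b)] f), totalVar g a b

/-- `φ ∈ C_c^∞ ]a,b[`, extended by zero to the line. -/
structure IsTestFunction (φ : ℝ → ℝ) (a b : ℝ) : Prop where
  contDiff : ContDiff ℝ (⊤ : ℕ∞) φ
  hasCompactSupport : HasCompactSupport φ
  tsupport_subset : tsupport φ ⊆ Ioo a b

/-- A finite signed Borel measure is Radon if both parts of its Jordan decomposition are: finite
on compact sets, outer regular on Borel sets, inner regular on open sets. -/
def IsRadon {X : Type*} [TopologicalSpace X] [MeasurableSpace X] (μ : SignedMeasure X) : Prop :=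
  μ.toJordanDecomposition.posPart.Regular ∧ μ.toJordanDecomposition.negPart.Regular

/-- `∫ φ dμ = ∫ φ dμ⁺ - ∫ φ dμ⁻` for a finite signed measure `μ`. -/
noncomputable def signedIntegral {X : Type*} [MeasurableSpace X] (μ : SignedMeasure X)
    (φ : X → ℝ) : ℝ :=
  (∫ x, φ x ∂μ.toJordanDecomposition.posPart) - ∫ x, φ x ∂μ.toJordanDecomposition.negPart

/-- The distributional derivative of `f` in `]a,b[` is (represented by) the finite signed Radon
measure `μ` in `]a,b[`. -/
def IsDistribDeriv (f : ℝ → ℝ) (a b : ℝ) (μ : SignedMeasure (Ioo a b)) : Prop :=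
  IsRadon μ ∧ ∀ φ : ℝ → ℝ, IsTestFunction φ a b →
    ∫ x in Ioo a b, f x * deriv φ x = -signedIntegral μ (fun x => φ x)

/-- `f ∈ BVL¹ ]a,b[`: `f ∈ L¹ ]a,b[`, and the distributional derivative of `f` is a finite signed
Radon measure in `]a,b[` of finite total variation. -/
def IsBVL1 (f : ℝ → ℝ) (a b : ℝ) : Prop :=
  IntegrableOn f (Ioo a b) ∧
    ∃ μ : SignedMeasure (Ioo a b), IsDistribDeriv f a b μ ∧ μ.totalVariation univ < ∞

end EssVar

/-! Two inequalities give the equality; each construction also yields one implication. If `g`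
represents `f` and has finite variation, Jordan's theorem writes `g = p - q` with `p`, `q` monotone
and their increments adding up to at most the variation of `g`. The Stieltjes measures of `p` and
`q` have difference `Df` and total mass at most that variation. The Jordan decomposition of `Df` is
minimal among such splittings, so `|Df|` is at most the variation of every representative
(`IsDistribDeriv.totalVariation_le`). Conversely, by Fubini the distribution function of `Df` has
distributional derivative `Df`. By du Bois-Reymond it differs from `f` by a constant almost
everywhere, so a translate of it is a representative, with variation at most `|Df|`
(`IsDistribDeriv.essVar_le`). -/

namespace EssVar

open Filter Topology

/-! ### Test functions and the du Bois-Reymond lemma -/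

section TestFunctions

variable {a b : ℝ} {φ ψ : ℝ → ℝ}

lemma IsTestFunction.sub (hφ : IsTestFunction φ a b) (hψ : IsTestFunction ψ a b) :
    IsTestFunction (fun x => φ x - ψ x) a b where
  contDiff := hφ.contDiff.sub hψ.contDiff
  hasCompactSupport := hφ.hasCompactSupport.sub hψ.hasCompactSupport
  tsupport_subset := (tsupport_sub φ ψ).trans
    (union_subset hφ.tsupport_subset hψ.tsupport_subset)

lemma IsTestFunction.const_mul (hφ : IsTestFunction φ a b) (r : ℝ) :
    IsTestFunction (fun x => r * φ x) a b where
  contDiff := contDiff_const.mul hφ.contDiff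
  hasCompactSupport := hφ.hasCompactSupport.mul_left (f := fun _ => r)
  tsupport_subset := (tsupport_mul_subset_right (f := fun _ => r)).trans hφ.tsupport_subset

lemma IsTestFunction.deriv (hφ : IsTestFunction φ a b) : IsTestFunction (deriv φ) a b where
  contDiff := (contDiff_infty_iff_deriv.1 hφ.contDiff).2
  hasCompactSupport := hφ.hasCompactSupport.deriv
  tsupport_subset := tsupport_deriv_subset.trans hφ.tsupport_subset

lemma IsTestFunction.continuous (hφ : IsTestFunction φ a b) : Continuous φ :=
  hφ.contDiff.continuous

lemma IsTestFunction.integrable (hφ : IsTestFunction φ a b) (m : Measure ℝ)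
    [IsLocallyFiniteMeasure m] : Integrable φ m :=
  hφ.continuous.integrable_of_hasCompactSupport hφ.hasCompactSupport

lemma IsTestFunction.eq_zero_of_notMem (hφ : IsTestFunction φ a b) {x : ℝ} (hx : x ∉ Ioo a b) :
    φ x = 0 :=
  image_eq_zero_of_notMem_tsupport fun h => hx (hφ.tsupport_subset h)

lemma IsTestFunction.integrable_mul (hφ : IsTestFunction φ a b) {m : Measure ℝ} {h : ℝ → ℝ}
    (hh : Integrable h m) : Integrable (fun x => h x * φ x) m := by
  obtain ⟨C, hC⟩ := hφ.hasCompactSupport.exists_bound_of_continuous hφ.continuous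
  exact hh.mul_bdd hφ.continuous.aestronglyMeasurable (ae_of_all _ hC)

lemma IsTestFunction.integral_deriv (hφ : IsTestFunction φ a b) :
    ∫ x, _root_.deriv φ x = 0 :=
  integral_eq_zero_of_hasDerivAt_of_integrable
    (fun x => ((contDiff_infty_iff_deriv.1 hφ.contDiff).1 x).hasDerivAt)
    (hφ.deriv.integrable volume) (hφ.integrable volume)

lemma exists_subset_Icc_of_isCompact (hab : a < b) {K : Set ℝ} (hK : IsCompact K)
    (hKab : K ⊆ Ioo a b) : ∃ c d, a < c ∧ d < b ∧ K ⊆ Icc c d := by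
  rcases K.eq_empty_or_nonempty with rfl | hne
  -- Any `c > a` and `d < b` serve for the empty set; no order between them is required.
  · exact ⟨b, a, hab, hab, empty_subset _⟩
  · exact ⟨sInf K, sSup K, (hKab (hK.sInf_mem hne)).1, (hKab (hK.sSup_mem hne)).2,
      fun x hx => ⟨csInf_le hK.bddBelow hx, le_csSup hK.bddAbove hx⟩⟩

/-- A test function of vanishing integral is the derivative of a test function. -/
lemma IsTestFunction.exists_deriv_eq (hab : a < b) (hψ : IsTestFunction ψ a b)
    (h0 : ∫ x, ψ x = 0) : ∃ φ, IsTestFunction φ a b ∧ _root_.deriv φ = ψ := by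
  obtain ⟨c, d, hc, hd, hcd⟩ :=
    exists_subset_Icc_of_isCompact hab hψ.hasCompactSupport hψ.tsupport_subset
  have hzero : ∀ x ∉ Icc c d, ψ x = 0 := fun x hx =>
    image_eq_zero_of_notMem_tsupport fun h => hx (hcd h)
  have hderiv : _root_.deriv (fun u => ∫ x in a..u, ψ x) = ψ :=
    funext fun x => hψ.continuous.deriv_integral ψ a x
  have hsupp : Function.support (fun u => ∫ x in a..u, ψ x) ⊆ Icc c d := by
    intro u hu
    by_contra hucd
    refine hu ?_
    by_cases hcu : u < c
    · refine (intervalIntegral.integral_congr fun x hx => ?_).trans intervalIntegral.integral_zero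
      exact hzero x fun h => absurd (h.1.trans hx.2) (not_le.2 (max_lt hc hcu))
    · have hdu : d < u := by
        by_contra hdu
        exact hucd ⟨not_lt.1 hcu, not_lt.1 hdu⟩
      have hau : a ≤ u := hc.le.trans (not_lt.1 hcu)
      change ∫ x in a..u, ψ x = 0
      rw [intervalIntegral.integral_of_le hau, ← h0]
      exact setIntegral_eq_integral_of_forall_compl_eq_zero fun x hx =>
        hzero x fun h => hx ⟨hc.trans_le h.1, h.2.trans hdu.le⟩
  have hts : tsupport (fun u => ∫ x in a..u, ψ x) ⊆ Icc c d := closure_minimal hsupp isClosed_Icc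
  refine ⟨fun u => ∫ x in a..u, ψ x, ⟨?_, ?_, ?_⟩, hderiv⟩
  · refine contDiff_infty_iff_deriv.2 ⟨fun x => ?_, by rw [hderiv]; exact hψ.contDiff⟩
    exact (intervalIntegral.integral_hasDerivAt_right (hψ.continuous.intervalIntegrable _ _)
      (hψ.continuous.stronglyMeasurableAtFilter _ _) hψ.continuous.continuousAt).differentiableAt
  · exact HasCompactSupport.of_support_subset_isCompact isCompact_Icc hsupp
  · exact hts.trans fun x hx => ⟨hc.trans_le hx.1, hx.2.trans_lt hd⟩

lemma exists_isTestFunction_integral_eq_one (hab : a < b) :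
    ∃ η, IsTestFunction η a b ∧ ∫ x, η x = 1 := by
  obtain ⟨θ, hθ, hθc, hθd, hθr, hθ1⟩ := exists_contDiff_tsupport_subset (n := ⊤)
    (Ioo_mem_nhds (left_lt_add_div_two.2 hab) (add_div_two_lt_right.2 hab))
  have hθT : IsTestFunction θ a b := ⟨hθd, hθc, hθ⟩
  have hpos : 0 < ∫ x, θ x := hθT.continuous.integral_pos_of_hasCompactSupport_nonneg_nonzero hθc
    (fun x => (hθr (mem_range_self x)).1) (x := (a + b) / 2) (by rw [hθ1]; exact one_ne_zero)
  refine ⟨_, hθT.const_mul (∫ x, θ x)⁻¹, ?_⟩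
  rw [integral_const_mul, inv_mul_cancel₀ hpos.ne']

/-- **Du Bois-Reymond lemma**: a function of vanishing distributional derivative is constant. -/
lemma ae_eq_const_of_integral_mul_deriv_eq_zero (hab : a < b) {h : ℝ → ℝ}
    (hh : IntegrableOn h (Ioo a b))
    (h0 : ∀ φ, IsTestFunction φ a b → ∫ x in Ioo a b, h x * deriv φ x = 0) :
    ∃ c : ℝ, h =ᵐ[volume.restrict (Ioo a b)] fun _ => c := by
  obtain ⟨η, hη, hη1⟩ := exists_isTestFunction_integral_eq_one hab
  set c := ∫ x in Ioo a b, h x * η x with hc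
  refine ⟨c, ?_⟩
  have key := isOpen_Ioo.ae_eq_zero_of_integral_contDiff_smul_eq_zero (U := Ioo a b)
    (μ := volume) (f := fun x => h x - c)
    (hh.sub (integrableOn_const (by simp))).locallyIntegrableOn ?_
  · refine (ae_restrict_iff' measurableSet_Ioo).2 ?_
    filter_upwards [key] with x hx hxab
    exact sub_eq_zero.1 (hx hxab)
  intro ψ hψd hψc hψs
  have hψ : IsTestFunction ψ a b := ⟨hψd, hψc, hψs⟩
  -- Subtracting `(∫ ψ) η` makes the integral vanish, so the hypothesis applies to a primitive of
  -- the difference.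
  obtain ⟨φ, hφ, hφψ⟩ := (hψ.sub (hη.const_mul (∫ x, ψ x))).exists_deriv_eq hab (by
    rw [integral_sub (hψ.integrable _) ((hη.const_mul _).integrable _), integral_const_mul, hη1,
      mul_one, sub_self])
  have hz := h0 φ hφ
  rw [hφψ] at hz
  have hz' : ∫ x in Ioo a b, h x * ψ x = (∫ x, ψ x) * c := by
    rw [hc, ← integral_const_mul, ← sub_eq_zero, ← integral_sub (hψ.integrable_mul hh)
      ((hη.integrable_mul hh).const_mul _), ← hz]
    exact integral_congr_ae (ae_of_all _ fun x => by ring)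
  have hψI : ∫ x in Ioo a b, ψ x = ∫ x, ψ x :=
    setIntegral_eq_integral_of_forall_compl_eq_zero fun x hx => hψ.eq_zero_of_notMem hx
  rw [← setIntegral_eq_integral_of_forall_compl_eq_zero (s := Ioo a b)
    fun x hx => by rw [hψ.eq_zero_of_notMem hx, zero_smul]]
  calc ∫ x in Ioo a b, ψ x • (h x - c) = ∫ x in Ioo a b, (h x * ψ x - c * ψ x) :=
        integral_congr_ae (ae_of_all _ fun x => by simp only [smul_eq_mul]; ring)
    _ = 0 := by
      rw [integral_sub (hψ.integrable_mul hh) ((hψ.integrable _).const_mul c), hz',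
        integral_const_mul, hψI, mul_comm, sub_self]

end TestFunctions

/-! ### Distribution functions, uniqueness and minimality of measures -/

section Measures

variable {a b : ℝ}

/-- Integration by parts against the distribution function of a finite measure. -/
lemma integral_eq_neg_integral_deriv_mul_measureReal_Iic (m : Measure ℝ) [IsFiniteMeasure m]
    {φ : ℝ → ℝ} (hφ : ContDiff ℝ 1 φ) (hφc : HasCompactSupport φ) :
    ∫ x, φ x ∂m = -∫ t, m.real (Iic t) * deriv φ t := by
  have hcont : Continuous (deriv φ) := hφ.continuous_deriv le_rfl
  have hint : Integrable (deriv φ) := hcont.integrable_of_hasCompactSupport hφc.deriv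
  have hprod : Integrable (Function.uncurry fun x t => (Ici x).indicator (deriv φ) t)
      (m.prod volume) := by
    have h := (hint.comp_snd m).indicator (measurableSet_le measurable_fst measurable_snd)
    refine h.congr (ae_of_all _ fun p => ?_)
    by_cases hp : p.1 ≤ p.2 <;> simp [indicator, Function.uncurry, hp]
  -- By compact support, `φ` is minus the integral of its derivative over the right half-line;
  -- exchanging the integrals turns `x ≤ t` into `x ∈ Iic t`.
  have h1 : ∀ x, φ x = -∫ t, (Ici x).indicator (deriv φ) t := fun x => by
    rw [integral_indicator measurableSet_Ici, integral_Ici_eq_integral_Ioi,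
      hφc.integral_Ioi_deriv_eq hφ, neg_neg]
  have h2 : ∀ t, ∫ x, (Ici x).indicator (deriv φ) t ∂m = m.real (Iic t) * deriv φ t := fun t => by
    rw [← smul_eq_mul, ← setIntegral_const, ← integral_indicator measurableSet_Iic]
    exact integral_congr_ae (ae_of_all _ fun x => by by_cases hx : x ≤ t <;> simp [indicator, hx])
  rw [integral_congr_ae (ae_of_all _ h1), integral_neg, integral_integral_swap hprod,
    integral_congr_ae (ae_of_all _ h2)]

/-- The image on the line of a measure in an open interval. -/
noncomputable abbrev toLine (m : Measure (Ioo a b)) : Measure ℝ := m.map Subtype.val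

lemma measurableEmbedding_val : MeasurableEmbedding (Subtype.val : Ioo a b → ℝ) :=
  MeasurableEmbedding.subtype_coe measurableSet_Ioo

instance (m : Measure (Ioo a b)) [IsFiniteMeasure m] : IsFiniteMeasure (toLine m) :=
  Measure.isFiniteMeasure_map m _

lemma toLine_univ (m : Measure (Ioo a b)) : toLine m univ = m univ := by
  rw [measurableEmbedding_val.map_apply, preimage_univ]

lemma integral_eq_neg_integral_toLine (m : Measure (Ioo a b)) [IsFiniteMeasure m] {φ : ℝ → ℝ}
    (hφ : IsTestFunction φ a b) :
    ∫ x, φ x ∂m = -∫ t in Ioo a b, (toLine m).real (Iic t) * deriv φ t := by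
  rw [← measurableEmbedding_val.integral_map, integral_eq_neg_integral_deriv_mul_measureReal_Iic _
    (hφ.contDiff.of_le (mod_cast le_top)) hφ.hasCompactSupport,
    setIntegral_eq_integral_of_forall_compl_eq_zero fun x hx => by
      rw [hφ.deriv.eq_zero_of_notMem hx, mul_zero]]

lemma monotone_measureReal_Iic (m : Measure ℝ) [IsFiniteMeasure m] :
    Monotone fun t => m.real (Iic t) :=
  fun _ _ h => measureReal_mono (Iic_subset_Iic.2 h)

lemma integrableOn_measureReal_Iic (m : Measure ℝ) [IsFiniteMeasure m] :
    IntegrableOn (fun t => m.real (Iic t)) (Ioo a b) :=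
  ((monotone_measureReal_Iic m).locallyIntegrable.integrableOn_isCompact isCompact_Icc).mono_set
    Ioo_subset_Icc_self

/-- Both measures have integrable densities with respect to `m₁ + m₂`. The difference of the
densities annihilates all test functions, hence vanishes almost everywhere in the interval by the
fundamental lemma of the calculus of variations for the measure `m₁ + m₂`. -/
lemma measure_eq_of_integral_eq_of_ae_mem (m₁ m₂ : Measure ℝ) [IsFiniteMeasure m₁]
    [IsFiniteMeasure m₂] (hm₁ : ∀ᵐ x ∂m₁, x ∈ Ioo a b) (hm₂ : ∀ᵐ x ∂m₂, x ∈ Ioo a b)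
    (h : ∀ φ : ℝ → ℝ, IsTestFunction φ a b → ∫ x, φ x ∂m₁ = ∫ x, φ x ∂m₂) : m₁ = m₂ := by
  have h₁ : m₁ ≪ m₁ + m₂ := Measure.absolutelyContinuous_of_le (Measure.le_add_right le_rfl)
  have h₂ : m₂ ≪ m₁ + m₂ := Measure.absolutelyContinuous_of_le (Measure.le_add_left le_rfl)
  have hint : Integrable (fun x => (m₁.rnDeriv (m₁ + m₂) x).toReal
      - (m₂.rnDeriv (m₁ + m₂) x).toReal) (m₁ + m₂) :=
    Measure.integrable_toReal_rnDeriv.sub Measure.integrable_toReal_rnDeriv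
  have key := isOpen_Ioo.ae_eq_zero_of_integral_contDiff_smul_eq_zero (U := Ioo a b)
    (hint.locallyIntegrable.locallyIntegrableOn _) fun φ hφd hφc hφs => by
      have hφ : IsTestFunction φ a b := ⟨hφd, hφc, hφs⟩
      have i₁ := (integrable_toReal_rnDeriv_mul_iff h₁ (f := φ)).2 (hφ.integrable m₁)
      have i₂ := (integrable_toReal_rnDeriv_mul_iff h₂ (f := φ)).2 (hφ.integrable m₂)
      rw [← sub_eq_zero.2 (h φ hφ), ← integral_toReal_rnDeriv_mul h₁,
        ← integral_toReal_rnDeriv_mul h₂, ← integral_sub i₁ i₂]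
      exact integral_congr_ae (ae_of_all _ fun x => by simp only [smul_eq_mul]; ring)
  have hd : m₁.rnDeriv (m₁ + m₂) =ᵐ[m₁ + m₂] m₂.rnDeriv (m₁ + m₂) := by
    filter_upwards [key, ae_add_measure_iff.2 ⟨hm₁, hm₂⟩, Measure.rnDeriv_lt_top m₁ (m₁ + m₂),
      Measure.rnDeriv_lt_top m₂ (m₁ + m₂)] with x hx hxab hx₁ hx₂
    exact (ENNReal.toReal_eq_toReal_iff' hx₁.ne hx₂.ne).1 (sub_eq_zero.1 (hx hxab))
  calc m₁ = (m₁ + m₂).withDensity (m₁.rnDeriv (m₁ + m₂)) :=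
        (Measure.withDensity_rnDeriv_eq _ _ h₁).symm
    _ = (m₁ + m₂).withDensity (m₂.rnDeriv (m₁ + m₂)) := withDensity_congr_ae hd
    _ = m₂ := Measure.withDensity_rnDeriv_eq _ _ h₂

/-- Finite measures in an open interval are determined by the integrals of test functions. -/
lemma measure_eq_of_integral_eq (m₁ m₂ : Measure (Ioo a b)) [IsFiniteMeasure m₁]
    [IsFiniteMeasure m₂]
    (h : ∀ φ : ℝ → ℝ, IsTestFunction φ a b → ∫ x, φ x ∂m₁ = ∫ x, φ x ∂m₂) : m₁ = m₂ := by
  have hmem : ∀ m : Measure (Ioo a b), ∀ᵐ x ∂(toLine m), x ∈ Ioo a b := fun m =>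
    measurableEmbedding_val.ae_map_iff.2 (ae_of_all _ fun x => x.2)
  have hline : toLine m₁ = toLine m₂ :=
    measure_eq_of_integral_eq_of_ae_mem _ _ (hmem m₁) (hmem m₂) fun φ hφ => by
      rw [measurableEmbedding_val.integral_map, measurableEmbedding_val.integral_map, h φ hφ]
  have := congrArg (Measure.comap (Subtype.val : Ioo a b → ℝ)) hline
  rwa [measurableEmbedding_val.comap_map, measurableEmbedding_val.comap_map] at this

/-- Minimality of the Jordan decomposition. -/
lemma totalVariation_univ_le_of_add_eq {X : Type*} [MeasurableSpace X] (μ : SignedMeasure X)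
    (m₁ m₂ : Measure X)
    (h : μ.toJordanDecomposition.posPart + m₂ = μ.toJordanDecomposition.negPart + m₁) :
    μ.totalVariation univ ≤ m₁ univ + m₂ univ := by
  -- Hahn decomposition: the negative part vanishes on `Sᶜ`, so there the hypothesis bounds the
  -- positive part by `m₁`; on `S` it bounds the negative part by `m₂`.
  obtain ⟨S, hS, hpos, hneg⟩ := μ.toJordanDecomposition.mutuallySingular
  have e₁ := congrArg (fun m => m Sᶜ) h
  have e₂ := congrArg (fun m => m S) h
  simp only [Measure.add_apply, hpos, hneg, zero_add] at e₁ e₂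
  rw [SignedMeasure.totalVariation, Measure.add_apply]
  refine add_le_add ?_ ?_
  · rw [← measure_add_measure_compl hS, hpos, zero_add]
    exact (le_self_add.trans e₁.le).trans (measure_mono (subset_univ _))
  · rw [← measure_add_measure_compl hS, hneg, add_zero]
    exact (le_self_add.trans e₂.symm.le).trans (measure_mono (subset_univ _))

end Measures

/-! ### Stieltjes measures in an open interval -/

section Stieltjes

variable {a b : ℝ}

/-- The Stieltjes measure of `F` in an open interval. -/
noncomputable def stieltjesMeasureIoo (F : StieltjesFunction ℝ) (a b : ℝ) : Measure (Ioo a b) :=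
  F.measure.comap Subtype.val

lemma toLine_stieltjesMeasureIoo (F : StieltjesFunction ℝ) :
    toLine (stieltjesMeasureIoo F a b) = F.measure.restrict (Ioo a b) := by
  rw [toLine, stieltjesMeasureIoo, measurableEmbedding_val.map_comap, Subtype.range_coe]

lemma stieltjesMeasureIoo_univ (F : StieltjesFunction ℝ) :
    stieltjesMeasureIoo F a b univ = F.measure (Ioo a b) := by
  rw [← toLine_univ, toLine_stieltjesMeasureIoo, Measure.restrict_apply_univ]

instance (F : StieltjesFunction ℝ) : IsFiniteMeasure (stieltjesMeasureIoo F a b) :=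
  ⟨by rw [stieltjesMeasureIoo_univ, F.measure_Ioo]; exact ENNReal.ofReal_lt_top⟩

lemma integrableOn_stieltjes (F : StieltjesFunction ℝ) : IntegrableOn F (Ioo a b) :=
  (F.mono.locallyIntegrable.integrableOn_isCompact isCompact_Icc).mono_set Ioo_subset_Icc_self

lemma integral_stieltjesMeasureIoo (F : StieltjesFunction ℝ) {φ : ℝ → ℝ}
    (hφ : IsTestFunction φ a b) :
    ∫ x, φ x ∂(stieltjesMeasureIoo F a b) = -∫ t in Ioo a b, F t * deriv φ t := by
  have hreal : ∀ t ∈ Ioo a b,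
      (toLine (stieltjesMeasureIoo F a b)).real (Iic t) = F t - F a := fun t ht => by
    have hset : Iic t ∩ Ioo a b = Ioc a t :=
      Set.ext fun x => ⟨fun h => ⟨h.2.1, h.1⟩, fun h => ⟨h.2, h.1, h.2.trans_lt ht.2⟩⟩
    rw [toLine_stieltjesMeasureIoo, measureReal_restrict_apply measurableSet_Iic, hset,
      measureReal_def, F.measure_Ioc, ENNReal.toReal_ofReal (sub_nonneg.2 (F.mono ht.1.le))]
  -- The distribution function is `F - F a` in the interval; the constant drops out because `deriv
  -- φ` has integral zero.
  rw [integral_eq_neg_integral_toLine _ hφ, neg_inj]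
  calc ∫ t in Ioo a b, (toLine (stieltjesMeasureIoo F a b)).real (Iic t) * deriv φ t
      = ∫ t in Ioo a b, (F t * deriv φ t - F a * deriv φ t) :=
        setIntegral_congr_fun measurableSet_Ioo fun t ht => by
          simp only [hreal t ht, sub_mul]
    _ = ∫ t in Ioo a b, F t * deriv φ t := by
      rw [integral_sub (hφ.deriv.integrable_mul (integrableOn_stieltjes F))
        ((hφ.deriv.integrable _).const_mul _), integral_const_mul,
        setIntegral_eq_integral_of_forall_compl_eq_zero
          fun x hx => hφ.deriv.eq_zero_of_notMem hx, hφ.integral_deriv, mul_zero, sub_zero]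

/-- The mass is the left limit at `b` minus `F a`: let `d` increase to `b`, then `c` decrease to
`a`, using right continuity at `a`. -/
lemma measure_Ioo_le_of_forall_sub_le (hab : a < b) (F : StieltjesFunction ℝ) {T : ℝ}
    (hF : ∀ c ∈ Ioo a b, ∀ d ∈ Ioo a b, c < d → F d - F c ≤ T) :
    F.measure (Ioo a b) ≤ ENNReal.ofReal T := by
  rw [F.measure_Ioo]
  refine ENNReal.ofReal_le_ofReal (sub_le_iff_le_add.2 ?_)
  have hleft : ∀ c ∈ Ioo a b, Function.leftLim F b ≤ T + F c := fun c hc => by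
    refine le_of_tendsto (F.mono.tendsto_leftLim b) ?_
    filter_upwards [Ioo_mem_nhdsLT hc.2] with d hd
    exact sub_le_iff_le_add.1 (hF c hc d ⟨hc.1.trans hd.1, hd.2⟩ hd.1)
  have hright : Tendsto (fun c => T + F c) (𝓝[>] a) (𝓝 (T + F a)) :=
    ((F.right_continuous a).mono Ioi_subset_Ici_self).tendsto.const_add T
  refine ge_of_tendsto hright ?_
  filter_upwards [Ioo_mem_nhdsGT hab] with c hc using hleft c hc

lemma stieltjesFunction_ae_eq {p : ℝ → ℝ} (hp : Monotone p) :
    hp.stieltjesFunction =ᵐ[volume] p := by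
  filter_upwards [hp.countable_not_continuousAt.ae_notMem volume] with x hx
  have hx' : ContinuousAt p x := not_not.1 hx
  exact hx'.continuousWithinAt.rightLim_eq

end Stieltjes

/-! ### Jordan decomposition of functions of bounded variation -/

section Variation

variable {a b : ℝ}

lemma eVariationOn_Icc_le_totalVar (g : ℝ → ℝ) {x y : ℝ} (hx : x ∈ Ioo a b) (hy : y ∈ Ioo a b) :
    eVariationOn g (Icc x y) ≤ totalVar g a b := by
  rcases lt_or_ge x y with hxy | hxy
  · exact le_iSup₂_of_le x y (le_iSup₂_of_le hx.1 hxy (le_iSup_of_le hy.2 le_rfl))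
  · rw [eVariationOn.subsingleton g fun u hu v hv =>
      (hu.2.trans (hxy.trans hv.1)).antisymm (hv.2.trans (hxy.trans hu.1))]
    exact zero_le

/-- A function whose increments are dominated by those of a bounded monotone function has bounded
variation. -/
lemma totalVar_le_of_abs_sub_le {g A : ℝ → ℝ} {T : ℝ≥0∞} (hA : Monotone A)
    (hgA : ∀ x y, x ≤ y → |g y - g x| ≤ A y - A x)
    (hT : ∀ x y, ENNReal.ofReal (A y - A x) ≤ T) : totalVar g a b ≤ T := by
  refine iSup₂_le fun c d => iSup₂_le fun _ hcd => iSup_le fun _ => ?_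
  have hle : eVariationOn g (Icc c d) ≤ eVariationOn A (Icc c d) := by
    refine iSup_le fun p => le_trans ?_ (eVariationOn.sum_le (n := p.1) p.2.2.1 p.2.2.2)
    refine Finset.sum_le_sum fun i _ => ?_
    rw [edist_dist, edist_dist, Real.dist_eq, Real.dist_eq]
    exact ENNReal.ofReal_le_ofReal ((hgA _ _ (p.2.2.1 i.le_succ)).trans (le_abs_self _))
  refine hle.trans (le_trans ?_ (hT c d))
  have := (hA.monotoneOn (Icc c d)).eVariationOn_eq (left_mem_Icc.2 hcd.le) (right_mem_Icc.2 hcd.le)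
  exact (inter_self (Icc c d) ▸ this).le

/-- Jordan's decomposition in its sharp form, where the increments of `p` and `q` add up to the
variation of `g`; this is what makes the final constant equal to one. Monotonicity on the whole line
is needed to form Stieltjes functions. -/
lemma exists_monotone_sub_monotone {g : ℝ → ℝ} (hab : a < b) (hg : totalVar g a b < ∞) :
    ∃ p q : ℝ → ℝ, Monotone p ∧ Monotone q ∧ (∀ x ∈ Ioo a b, g x = p x - q x) ∧
      ∀ x ∈ Ioo a b, ∀ y ∈ Ioo a b, x ≤ y →
        (p y - p x) + (q y - q x) ≤ (totalVar g a b).toReal := by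
  have hsub : ∀ x ∈ Ioo a b, ∀ y ∈ Ioo a b, eVariationOn g (Ioo a b ∩ Icc x y) ≤ totalVar g a b :=
    fun x hx y hy => (eVariationOn.mono g inter_subset_right).trans
      (eVariationOn_Icc_le_totalVar g hx hy)
  have hloc : LocallyBoundedVariationOn g (Ioo a b) := fun x y hx hy =>
    ((hsub x hx y hy).trans_lt hg).ne
  obtain ⟨p, q, hp, hq, hpq, hvar⟩ := hloc.exists_monotoneOn_sub_monotoneOn'
  have hT : ∀ x ∈ Ioo a b, ∀ y ∈ Ioo a b, x ≤ y →
      (p y - p x) + (q y - q x) ≤ (totalVar g a b).toReal := fun x hx y hy hxy => by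
    rw [hvar x hx y hy, variationOnFromTo.eq_of_le _ _ hxy]
    exact ENNReal.toReal_mono hg.ne (hsub x hx y hy)
  -- A monotone function extends from the interval to the line once it is bounded there; `r` stays
  -- within the total variation of its value at the midpoint. The statement serves for `p` and `q`
  -- with the roles exchanged.
  have hbdd : ∀ r s : ℝ → ℝ, MonotoneOn r (Ioo a b) → MonotoneOn s (Ioo a b) →
      (∀ x ∈ Ioo a b, ∀ y ∈ Ioo a b, x ≤ y →
        (r y - r x) + (s y - s x) ≤ (totalVar g a b).toReal) →
      ∃ r' : ℝ → ℝ, Monotone r' ∧ EqOn r r' (Ioo a b) := fun r s hr hs h => by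
    have hz : (a + b) / 2 ∈ Ioo a b :=
      ⟨left_lt_add_div_two.2 hab, add_div_two_lt_right.2 hab⟩
    have h' : ∀ x ∈ Ioo a b, ∀ y ∈ Ioo a b, x ≤ y → r y - r x ≤ (totalVar g a b).toReal :=
      fun x hx y hy hxy => by linarith [h x hx y hy hxy, hs hx hy hxy]
    have hT0 : 0 ≤ (totalVar g a b).toReal := ENNReal.toReal_nonneg
    refine hr.exists_monotone_extension
      ⟨r ((a + b) / 2) - (totalVar g a b).toReal, ?_⟩
      ⟨r ((a + b) / 2) + (totalVar g a b).toReal, ?_⟩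
    · rintro _ ⟨x, hx, rfl⟩
      rcases le_total x ((a + b) / 2) with hxz | hxz
      · linarith [h' x hx _ hz hxz]
      · linarith [hr hz hx hxz]
    · rintro _ ⟨x, hx, rfl⟩
      rcases le_total x ((a + b) / 2) with hxz | hxz
      · linarith [hr hx hz hxz]
      · linarith [h' _ hz x hx hxz]
  obtain ⟨p', hp', hpp'⟩ := hbdd p q hp hq hT
  obtain ⟨q', hq', hqq'⟩ := hbdd q p hq hp fun x hx y hy hxy => by
    linarith [hT x hx y hy hxy]
  refine ⟨p', q', hp', hq', fun x hx => ?_, fun x hx y hy hxy => ?_⟩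
  · rw [hpq, Pi.sub_apply, hpp' hx, hqq' hx]
  · rw [← hpp' hx, ← hpp' hy, ← hqq' hx, ← hqq' hy]
    exact hT x hx y hy hxy

/-- The derivative of a function of bounded variation is the difference of two measures whose
masses add up to at most the variation. -/
lemma exists_measures_of_totalVar_lt_top {g : ℝ → ℝ} (hab : a < b) (hg : totalVar g a b < ∞) :
    ∃ (m₁ m₂ : Measure (Ioo a b)) (_ : IsFiniteMeasure m₁) (_ : IsFiniteMeasure m₂),
      m₁ univ + m₂ univ ≤ totalVar g a b ∧ ∀ φ : ℝ → ℝ, IsTestFunction φ a b →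
        ∫ x in Ioo a b, g x * deriv φ x = -((∫ x, φ x ∂m₁) - ∫ x, φ x ∂m₂) := by
  obtain ⟨p, q, hp, hq, hpq, hT⟩ := exists_monotone_sub_monotone hab hg
  refine ⟨stieltjesMeasureIoo hp.stieltjesFunction a b,
    stieltjesMeasureIoo hq.stieltjesFunction a b, inferInstance, inferInstance, ?_, ?_⟩
  · rw [stieltjesMeasureIoo_univ, stieltjesMeasureIoo_univ, ← Measure.add_apply,
      ← StieltjesFunction.measure_add]
    refine (measure_Ioo_le_of_forall_sub_le hab _ (T := (totalVar g a b).toReal)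
      fun c hc d hd hcd => ?_).trans_eq (ENNReal.ofReal_toReal hg.ne)
    -- Passing to right limits may increase the value at `d`, but not beyond the value at any `e >
    -- d`.
    obtain ⟨e, hde, heb⟩ := exists_between hd.2
    have := hT c hc e ⟨hd.1.trans hde, heb⟩ (hcd.trans hde).le
    simp only [StieltjesFunction.add_apply, Monotone.stieltjesFunction_eq]
    linarith [hp.rightLim_le hde, hq.rightLim_le hde, hp.le_rightLim (le_refl c),
      hq.le_rightLim (le_refl c)]
  · intro φ hφ
    rw [integral_stieltjesMeasureIoo _ hφ, integral_stieltjesMeasureIoo _ hφ, neg_sub_neg,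
      neg_sub, ← integral_sub (hφ.deriv.integrable_mul (integrableOn_stieltjes _))
        (hφ.deriv.integrable_mul (integrableOn_stieltjes _))]
    refine integral_congr_ae ?_
    filter_upwards [ae_restrict_of_ae (stieltjesFunction_ae_eq hp),
      ae_restrict_of_ae (stieltjesFunction_ae_eq hq), ae_restrict_mem measurableSet_Ioo]
      with x hx₁ hx₂ hx
    rw [hx₁, hx₂, hpq x hx, sub_mul]

end Variation

/-! ### The two inequalities -/

section Main

variable {a b : ℝ} {f : ℝ → ℝ}

/-- Finite Borel measures on a locally compact, second countable metric space are regular. -/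
lemma isRadon_of_Ioo (μ : SignedMeasure (Ioo a b)) : IsRadon μ := by
  have : LocallyCompactSpace (Ioo a b) := isOpen_Ioo.locallyCompactSpace
  exact ⟨inferInstance, inferInstance⟩

lemma integral_mul_congr_ae {g ψ : ℝ → ℝ} (hgf : g =ᵐ[volume.restrict (Ioo a b)] f) :
    ∫ x in Ioo a b, g x * ψ x = ∫ x in Ioo a b, f x * ψ x :=
  integral_congr_ae (hgf.mono fun x hx => by simp only [hx])

lemma IsTestFunction.integrable_subtype {φ : ℝ → ℝ} (hφ : IsTestFunction φ a b)
    (m : Measure (Ioo a b)) [IsFiniteMeasure m] : Integrable (fun x : Ioo a b => φ x) m :=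
  measurableEmbedding_val.integrable_map_iff.1 (hφ.integrable (toLine m))

lemma exists_isDistribDeriv {g : ℝ → ℝ} (hab : a < b) (hg : totalVar g a b < ∞)
    (hgf : g =ᵐ[volume.restrict (Ioo a b)] f) :
    ∃ μ : SignedMeasure (Ioo a b), IsDistribDeriv f a b μ := by
  obtain ⟨m₁, m₂, _, _, -, hm⟩ := exists_measures_of_totalVar_lt_top hab hg
  refine ⟨m₁.toSignedMeasure - m₂.toSignedMeasure, isRadon_of_Ioo _, fun φ hφ => ?_⟩
  rw [← integral_mul_congr_ae hgf, hm φ hφ, neg_inj, signedIntegral]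
  set μ := m₁.toSignedMeasure - m₂.toSignedMeasure with hμ
  -- The masses `m₁`, `m₂` need not be mutually singular, so they may differ from the Jordan parts
  -- of `μ`; only the differences agree, written here without subtraction.
  have hsum : μ.toJordanDecomposition.posPart + m₂ = μ.toJordanDecomposition.negPart + m₁ := by
    rw [← Measure.toSignedMeasure_eq_toSignedMeasure_iff, Measure.toSignedMeasure_add,
      Measure.toSignedMeasure_add]
    have h := μ.toSignedMeasure_toJordanDecomposition
    rw [JordanDecomposition.toSignedMeasure, hμ] at h
    rw [sub_eq_sub_iff_add_eq_add] at h
    rw [h, add_comm]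
  have h := congrArg (fun m => ∫ x : Ioo a b, φ x ∂m) hsum
  simp only [integral_add_measure (hφ.integrable_subtype _) (hφ.integrable_subtype _)] at h
  linarith

/-- The total variation of the distributional derivative is at most the variation of any
representative. -/
lemma IsDistribDeriv.totalVariation_le {μ : SignedMeasure (Ioo a b)} (hab : a < b)
    (hμ : IsDistribDeriv f a b μ) : μ.totalVariation univ ≤ essVar f a b := by
  refine le_iInf₂ fun g hgf => ?_
  rcases eq_or_ne (totalVar g a b) ∞ with htop | hg
  · exact htop ▸ le_top
  obtain ⟨m₁, m₂, _, _, hle, hm⟩ := exists_measures_of_totalVar_lt_top hab hg.lt_top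
  refine (totalVariation_univ_le_of_add_eq μ m₁ m₂ ?_).trans hle
  refine measure_eq_of_integral_eq _ _ fun φ hφ => ?_
  have h := hm φ hφ
  rw [integral_mul_congr_ae hgf, hμ.2 φ hφ, neg_inj, signedIntegral] at h
  rw [integral_add_measure (hφ.integrable_subtype _) (hφ.integrable_subtype _),
    integral_add_measure (hφ.integrable_subtype _) (hφ.integrable_subtype _)]
  linarith

/-- The distribution function of the distributional derivative is, up to a constant, a
representative whose variation is at most the total variation of the derivative. -/
lemma IsDistribDeriv.essVar_le {μ : SignedMeasure (Ioo a b)} (hab : a < b)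
    (hf : IntegrableOn f (Ioo a b)) (hμ : IsDistribDeriv f a b μ) :
    essVar f a b ≤ μ.totalVariation univ := by
  set P := toLine μ.toJordanDecomposition.posPart
  set N := toLine μ.toJordanDecomposition.negPart
  have hP : IntegrableOn (fun t => P.real (Iic t)) (Ioo a b) := integrableOn_measureReal_Iic P
  have hN : IntegrableOn (fun t => N.real (Iic t)) (Ioo a b) := integrableOn_measureReal_Iic N
  obtain ⟨c, hc⟩ := ae_eq_const_of_integral_mul_deriv_eq_zero hab
    (h := fun t => f t - (P.real (Iic t) - N.real (Iic t))) (hf.sub (hP.sub hN)) fun φ hφ => by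
      have h := hμ.2 φ hφ
      rw [signedIntegral, integral_eq_neg_integral_toLine _ hφ,
        integral_eq_neg_integral_toLine _ hφ] at h
      have iP := hφ.deriv.integrable_mul hP
      have iN := hφ.deriv.integrable_mul hN
      have iPN : Integrable (fun t => P.real (Iic t) * deriv φ t - N.real (Iic t) * deriv φ t)
        (volume.restrict (Ioo a b)) := iP.sub iN
      simp only [sub_mul]
      rw [integral_sub (hφ.deriv.integrable_mul hf) iPN, integral_sub iP iN, h]
      ring
  refine (iInf₂_le (fun t => P.real (Iic t) - N.real (Iic t) + c) ?_).trans ?_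
  · filter_upwards [hc] with t ht
    rw [← ht]
    ring
  have hmono : ∀ (m : Measure ℝ) [IsFiniteMeasure m], ∀ x y, x ≤ y →
      m.real (Iic x) ≤ m.real (Iic y) := fun m _ x y h => monotone_measureReal_Iic m h
  -- The increments of `P - N + c` are dominated by those of `P + N`, the distribution function of
  -- the total variation measure.
  refine totalVar_le_of_abs_sub_le (A := fun t => P.real (Iic t) + N.real (Iic t))
    (fun x y h => add_le_add (hmono P x y h) (hmono N x y h)) (fun x y h => ?_) fun x y => ?_
  · have h₁ := hmono P x y h
    have h₂ := hmono N x y h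
    rw [abs_le]
    constructor <;> linarith
  · rw [SignedMeasure.totalVariation, Measure.add_apply, ← toLine_univ, ← toLine_univ]
    calc ENNReal.ofReal (P.real (Iic y) + N.real (Iic y) - (P.real (Iic x) + N.real (Iic x)))
        ≤ ENNReal.ofReal (P.real (Iic y) + N.real (Iic y)) :=
          ENNReal.ofReal_le_ofReal (sub_le_self _ (by positivity))
      _ = P (Iic y) + N (Iic y) := by
        rw [ENNReal.ofReal_add measureReal_nonneg measureReal_nonneg, ofReal_measureReal,
          ofReal_measureReal]
      _ ≤ P univ + N univ := add_le_add (measure_mono (subset_univ _)) (measure_mono (subset_univ _))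

end Main

end EssVar

theorem mainTheorem5 (a b : ℝ) (hab : a < b) (f : ℝ → ℝ) (hf : IntegrableOn f (Ioo a b)) :
    (EssVar.essVar f a b < ∞ ↔ EssVar.IsBVL1 f a b) ∧
      ∀ μ : SignedMeasure (Ioo a b), EssVar.IsDistribDeriv f a b μ →
        μ.totalVariation univ = EssVar.essVar f a b := by
  refine ⟨⟨fun h => ⟨hf, ?_⟩, fun ⟨_, μ, hμ, hlt⟩ => (hμ.essVar_le hab hf).trans_lt hlt⟩,
    fun μ hμ => (hμ.totalVariation_le hab).antisymm (hμ.essVar_le hab hf)⟩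
  obtain ⟨g, hg⟩ := iInf_lt_iff.1 h
  obtain ⟨hgf, hg⟩ := iInf_lt_iff.1 hg
  obtain ⟨μ, hμ⟩ := EssVar.exists_isDistribDeriv hab hg hgf
  exact ⟨μ, hμ, (hμ.totalVariation_le hab).trans_lt h⟩
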